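/- For $s\in(0,2]$ let $T_s\colon[-1,1]\to[-1,1]$, $T_s(x)=s(1-|x|)-1$, with turning point $0$. Its kneading invariant is the sequence $e_1,e_2,\dots$ in $\{0,1\}$ with $e_j=0$ (resp. $e_j=1$) if $T_s^j(y)<0$ (resp. $T_s^j(y)>0$) for all sufficiently small $y>0$. $T_s$ has Fibonacci recurrence if its kneading map is $Q(k)=\max\{0,k-2\}$, i.e. if, with $S(0)=1$ and $S(k)=S(k-1)+S(Q(k))$ for $k\ge1$, one has $e_1=1$ and $$e_{S(k-1)+1}\cdots e_{S(k)}=e_1\cdots e_{S(Q(k))-1}\,(1-e_{S(Q(k))})\qquad(k\ge1).$$ Let $\lambda_F\in(0,2]$ be such that $T=T_{\lambda_F}$ has Fibonacci recurrence, and let $\mu_P$ be the $T$-invariant ergodic Borel probability measure supported on $\overline{\{T^n(0):n\ge0\}}$. A critical point of $g\colon[-1,1]\to[-1,1]$ is a point $\hat c$ with $g'(\hat c)=0$ (derivatives at $\pm1$ are one-sided). It is non-flat if there are $\alpha^+,\alpha^-,M,\delta>0$ such that $g'(x)\neq0$ and $\bigl|\log\bigl(|g'(x)|/|x-\hat c|^{\alpha^{\pm}}\bigr)\bigr|\le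 M$ for all $x\in[-1,1]$ with $0<\pm(x-\hat c)<\delta$. Let $h\colon[-1,1]\to[-1,1]$ be a homeomorphism that is real analytic on $[-1,1]\setminus\{0\}$ and has $0$ as its unique critical point, this critical point being non-flat. Put $f=h\circ T\circ h^{-1}$, $\tilde c=h(0)$, $\tilde\mu_P=h_*\mu_P$ and $\mathcal S(f)=\{x: f'(x)=0\}\cup\{\tilde c\}$. Write $\log^+|f'|=\max\{0,\log|f'|\}$ and $\log^-|f'|=\max\{0,-\log|f'|\}$ on $[-1,1]\setminus\{\tilde c\}$, where $f$ is differentiable and $\log 0=-\infty$. Then (i) $\displaystyle\int_{[-1,1]\setminus\{\tilde c\}}\log^+|f'|\,d\tilde\mu_P=+\infty$; (ii) $\displaystyle\int_{[-1,1]\setminus\{\tilde c\}}\log^-|f'|\,d\tilde\mu_P=+\infty$, i.e. $\displaystyle\int_{[-1,1]\setminus\{\tilde c\}}\min\{0,\log|f'|\}\,d\tilde\mu_P=-\infty$; (iii) $\displaystyle\int\bigl|\log\operatorname{dist}(\cdot,\mathcal S(f))\bigr|\,d\tilde\mu_P=+\infty$. Consequently the Lyapunov exponent $\int\log|f'|\,d\tilde\mu_P$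 is not defined, and $\log\operatorname{dist}(\cdot,\mathcal S(f))\notin L^1(\tilde\mu_P)$. -/

import Mathlib

open MeasureTheory Set Filter Topology
open scoped ENNReal

noncomputable section

/-- The phase space `[-1, 1]`, with its metric, order and Borel structure. -/
abbrev SymmIcc : Type := Set.Icc (-1 : ℝ) 1

namespace SymmIcc

/-- The point `0` of `[-1, 1]`. -/
def origin : SymmIcc := ⟨0, by norm_num, by norm_num⟩

/-! ### Derivatives, critical points, non-flatness -/

/-- A self-map of `[-1, 1]` as a real function; only its values on `[-1, 1]` are ever used. -/
def toReal (g : SymmIcc → SymmIcc) : ℝ → ℝ :=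
  Set.IccExtend (by norm_num : (-1 : ℝ) ≤ 1) (fun x => (g x : ℝ))

/-- The derivative `g' x` (one-sided at the two endpoints). -/
def derivAt (g : SymmIcc → SymmIcc) (x : SymmIcc) : ℝ :=
  derivWithin (toReal g) (Set.Icc (-1) 1) x

/-- The set of critical points: `g` is differentiable at `x` and `g' x = 0`. -/
def critSet (g : SymmIcc → SymmIcc) : Set SymmIcc :=
  {x | HasDerivWithinAt (toReal g) 0 (Set.Icc (-1) 1) x}

/-- `c` is a non-flat critical point of `g`. The logarithm in the defining bound is that of a
positive number, which is why `g' x ≠ 0` is recorded explicitly. -/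
def IsNonFlatCritPt (g : SymmIcc → SymmIcc) (c : SymmIcc) : Prop :=
  c ∈ critSet g ∧
  ∃ αp > (0 : ℝ), ∃ αm > (0 : ℝ), ∃ M > (0 : ℝ), ∃ δ > (0 : ℝ),
    (∀ x : SymmIcc, (c : ℝ) < x → (x : ℝ) < c + δ →
      derivAt g x ≠ 0 ∧ |Real.log (|derivAt g x| / |(x : ℝ) - c| ^ αp)| ≤ M) ∧
    (∀ x : SymmIcc, (c : ℝ) - δ < x → (x : ℝ) < c →
      derivAt g x ≠ 0 ∧ |Real.log (|derivAt g x| / |(x : ℝ) - c| ^ αm)| ≤ M)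

/-- The set `S(g) = Crit(g) ∪ {c}`, where `c` is the turning point of `g`. -/
def singSet (g : SymmIcc → SymmIcc) (c : SymmIcc) : Set SymmIcc :=
  critSet g ∪ {c}

/-! ### Kneading theory -/

/-- The symbols `0`, `1` and `c` of itineraries. -/
inductive Symbol
  | zero
  | one
  | turn

/-- `e ↦ 1 - e` on the symbols `0`, `1`. -/
def Symbol.flip : Symbol → Symbol
  | zero => one
  | one => zero
  | turn => turn

open Classical in
/-- The itinerary of `x` under `g`, relative to the turning point `c`. -/
def itinerary (g : SymmIcc → SymmIcc) (c x : SymmIcc) (n : ℕ) : Symbol :=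
  if g^[n] x < c then .zero else if c < g^[n] x then .one else .turn

/-- `e 1, e 2, …` is the kneading invariant of `g`, that is,
`e j = lim_{y ↓ c} i_j(y)` for every `j ≥ 1` (the value `e 0` is irrelevant). -/
def IsKneadingInvariant (g : SymmIcc → SymmIcc) (c : SymmIcc) (e : ℕ → Symbol) : Prop :=
  ∀ j, 1 ≤ j → ∀ᶠ y in 𝓝[>] c, itinerary g c y j = e j

/-- `Q` is the kneading map of `g`. With the cutting times `S 0 = 1`, `S k = S (k-1) + S (Q k)`,
the kneading invariant satisfies `e 1 = 1` and
`e (S(k-1)+1) … e (S k) = e 1 … e (S(Q k)-1) (1 - e (S (Q k)))` for every `k ≥ 1`. -/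
def HasKneadingMap (g : SymmIcc → SymmIcc) (c : SymmIcc) (Q : ℕ → ℕ) : Prop :=
  (∀ k, 1 ≤ k → Q k < k) ∧
  ∃ (S : ℕ → ℕ) (e : ℕ → Symbol),
    S 0 = 1 ∧ (∀ k, 1 ≤ k → S k = S (k - 1) + S (Q k)) ∧
    IsKneadingInvariant g c e ∧ e 1 = .one ∧
    ∀ k, 1 ≤ k →
      (∀ i, 1 ≤ i → i < S (Q k) → e (S (k - 1) + i) = e i) ∧
      e (S (k - 1) + S (Q k)) = (e (S (Q k))).flip

/-- Fibonacci recurrence: the kneading map is `Q k = max 0 (k - 2)`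
(truncated subtraction of natural numbers). -/
def HasFibonacciRecurrence (g : SymmIcc → SymmIcc) (c : SymmIcc) : Prop :=
  HasKneadingMap g c (fun k => k - 2)

/-! ### The tent family and the maps conjugate to it -/

/-- The tent map `x ↦ s (1 - |x|) - 1` of `[-1, 1]`, for `0 < s ≤ 2`. -/
def tentMap (s : ℝ) (hs : s ∈ Set.Ioc (0 : ℝ) 2) (x : SymmIcc) : SymmIcc :=
  ⟨s * (1 - |(x : ℝ)|) - 1, by
    have h1 : |(x : ℝ)| ≤ 1 := abs_le.2 x.2
    have h0 : 0 ≤ |(x : ℝ)| := abs_nonneg _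
    obtain ⟨h2, h3⟩ := hs
    constructor <;> nlinarith⟩

/-- The orbit `{gⁿ x : n ≥ 0}`. -/
def orbit (g : SymmIcc → SymmIcc) (x : SymmIcc) : Set SymmIcc :=
  Set.range fun n : ℕ => g^[n] x

/-- `h` is of class `C^ω` on `[-1, 1] \ {0}`, and `0` is its unique critical point and is
non-flat. -/
structure IsAdmissible (h : SymmIcc ≃ₜ SymmIcc) : Prop where
  analytic : AnalyticOn ℝ (toReal h) (Set.Icc (-1) 1 \ {0})
  crit : critSet h = {origin}
  nonFlat : IsNonFlatCritPt h origin

/-- The conjugate `h ∘ g ∘ h⁻¹`. -/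
def conj (h : SymmIcc ≃ₜ SymmIcc) (g : SymmIcc → SymmIcc) : SymmIcc → SymmIcc :=
  h ∘ g ∘ h.symm

/-! ### Logarithms and integrals -/

/-- `log |g' x|` as an extended real number, equal to `-∞` where `g' x = 0`. It is meaningful
where `g` is differentiable. -/
def logAbsDeriv (g : SymmIcc → SymmIcc) (x : SymmIcc) : EReal :=
  ENNReal.log (ENNReal.ofReal |derivAt g x|)

/-- `log (dist (x, A))` as an extended real number, equal to `-∞` where the distance is `0`. -/
def logDist (A : Set SymmIcc) (x : SymmIcc) : EReal :=
  ENNReal.log (ENNReal.ofReal (Metric.infDist x A))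

/-- `∫ max(0, F) dμ`, an element of `[0, ∞]`. -/
def integralPos (F : SymmIcc → EReal) (μ : Measure SymmIcc) : ℝ≥0∞ :=
  ∫⁻ x, (F x).toENNReal ∂μ

/-- `∫ max(0, -F) dμ`, an element of `[0, ∞]`. -/
def integralNeg (F : SymmIcc → EReal) (μ : Measure SymmIcc) : ℝ≥0∞ :=
  ∫⁻ x, (-F x).toENNReal ∂μ

/-- The integral `∫ F dμ ∈ [-∞, ∞]` exists, i.e. it is not of the form `∞ - ∞`. -/
def IntegralExists (F : SymmIcc → EReal) (μ : Measure SymmIcc) : Prop :=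
  integralPos F μ ≠ ⊤ ∨ integralNeg F μ ≠ ⊤

end SymmIcc

end

/-!
# Non-integrability of `log |f'|` for Fibonacci recurrence

Let `T` be the tent map of slope `s` with Fibonacci recurrence and `S k` its cutting times, which
are Fibonacci numbers. Everything follows from the divergence of `∫ -log |x| dμ(x)` near `0` for an
invariant probability measure `μ` carried by the closure of the orbit of the turning point `0`.

* The kneading invariant is a concatenation of blocks of lengths `S k` and `S (k + 1)`, each of
  which begins with its first `S k - 1` symbols (`exists_recurrence_time_le`). A point of the orbit
  of `0` followed by these symbols shadows that orbit for `S k` steps, and `T` expands by `s` on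
  each side of `0`, so the point lies within `2 / s ^ S k` of `0`. Hence the orbit of `0` visits the
  ball of this radius once in every `S (k + 1) + 1` steps
  (`SymmIcc.HasFibonacciRecurrence.close_returns`), and so the ball has mass at least
  `1 / (S (k + 1) + 1)` (`SymmIcc.one_le_mul_measure_of_returns`).
* On this ball `-log |x|` is at least of the order of `S k`, so its integral over the ball does not
  tend to zero. The point `0` is not periodic, since the kneading invariant is not, so it has
  measure zero and the integral over the whole interval diverges
  (`SymmIcc.lintegral_eq_top_of_log_le`).
* At `h x` the chain rule gives `|f'| = s |h' (T x)| / |h' x|`, and `|h' x| ≤ exp M * |x| ^ a` near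
  `0` by non-flatness. Thus `log |f'|` is at least `-a log |x|` up to a constant near `x = 0`, while
  `-log |f'|` is at least `-a log |T x|` up to a constant near the preimages of `0`; by invariance
  both integrals diverge. Finally, `h` contracts distances to `0` near `0`, so the distance from
  `h x` to the singular set is at most `|x|`.
-/

/-! ### Recurrence in Fibonacci sequences of symbols -/

/-- A sequence with the Fibonacci block structure is a concatenation of blocks of lengths `S k` and
`S (k + 1)`, each of which begins with `e 1, …, e (S k - 1)`. Hence every `n` has a predecessor `p`
within distance `S (k + 1)` after which these symbols are read again. -/
theorem exists_recurrence_time_le {α : Type*} {S : ℕ → ℕ} {e : ℕ → α} (hS : StrictMono S)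
    (hadd : ∀ k, S (k + 2) = S (k + 1) + S k)
    (he : ∀ k i, 1 ≤ i → i < S k → e (S (k + 1) + i) = e i) (k m : ℕ) :
    ∀ n < S (m + k), ∃ p ≤ n, n < p + S (k + 1) ∧ p + S k ≤ S (m + k) ∧
      ∀ i, 1 ≤ i → i < S k → e (p + i) = e i := by
  have hk : S k < S (k + 1) := hS (Nat.lt_succ_self k)
  induction m using Nat.twoStepInduction with
  | zero => exact fun n hn => ⟨0, by omega, by simp at hn; omega, by simp, fun i _ _ => by simp⟩
  | one =>
    refine fun n hn => ⟨0, by omega, ?_, ?_, fun i _ _ => by simp⟩ <;>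
      rw [Nat.add_comm 1 k] at * <;> omega
  | more m ih0 ih1 =>
    intro n hn
    have e1 : S (m + 2 + k) = S (m + k + 1) + S (m + k) := by
      rw [← hadd]; congr 1; omega
    have e2 : S (m + 1 + k) = S (m + k + 1) := by congr 1; omega
    rw [e2] at ih1
    rcases lt_or_ge n (S (m + k + 1)) with h | h
    · obtain ⟨p, h1, h2, h3, h4⟩ := ih1 n h
      exact ⟨p, h1, h2, by omega, h4⟩
    · obtain ⟨p, h1, h2, h3, h4⟩ := ih0 (n - S (m + k + 1)) (by omega)
      refine ⟨S (m + k + 1) + p, by omega, by omega, by omega, fun i hi hik => ?_⟩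
      rw [Nat.add_assoc, he (m + k) (p + i) (by omega) (by omega), h4 i hi hik]

/-- A sequence with the Fibonacci block structure is not periodic: a period `< S k` would force the
mismatch at position `S k` of a block to disappear. -/
theorem not_periodic_of_mismatch {α : Type*} {S : ℕ → ℕ} {e : ℕ → α} (hS : StrictMono S)
    (he : ∀ k i, 1 ≤ i → i < S k → e (S (k + 1) + i) = e i)
    (hne : ∀ k, e (S (k + 1) + S k) ≠ e (S k)) {p : ℕ} (hp : 1 ≤ p) :
    ¬ ∀ j, 1 ≤ j → e (p + j) = e j := by
  intro hper
  have hk : p + 1 ≤ S (p + 1) := hS.id_le (p + 1)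
  refine hne (p + 1) ?_
  have h1 := hper (S (p + 1) - p) (by omega)
  have h2 := hper (S (p + 2) + (S (p + 1) - p)) (by omega)
  have h3 := he (p + 1) (S (p + 1) - p) (by omega) (by omega)
  rw [show p + (S (p + 1) - p) = S (p + 1) by omega] at h1
  rw [show p + (S (p + 2) + (S (p + 1) - p)) = S (p + 2) + S (p + 1) by omega] at h2
  rw [h1, ← h3, h2]

namespace SymmIcc

/-! ### The tent map -/

@[simp] theorem coe_origin : ((origin : SymmIcc) : ℝ) = 0 := rfl

theorem coe_tentMap (s : ℝ) (hs : s ∈ Ioc (0 : ℝ) 2) (x : SymmIcc) :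
    (tentMap s hs x : ℝ) = s * (1 - |(x : ℝ)|) - 1 := rfl

theorem ne_origin_iff {x : SymmIcc} : x ≠ origin ↔ (x : ℝ) ≠ 0 := by
  rw [Ne, Subtype.ext_iff, coe_origin]

theorem continuous_tentMap (s : ℝ) (hs : s ∈ Ioc (0 : ℝ) 2) : Continuous (tentMap s hs) :=
  Continuous.subtype_mk (by fun_prop) _

/-- The tent map expands by exactly `s ^ N` along orbits that stay on the same side of `0`. -/
theorem abs_iterate_tentMap_sub (s : ℝ) (hs : s ∈ Ioc (0 : ℝ) 2) (x : SymmIcc) (N : ℕ)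
    (hx : ∀ i, 1 ≤ i → i < N →
      0 < ((tentMap s hs)^[i] x : ℝ) * ((tentMap s hs)^[i] origin : ℝ)) :
    |((tentMap s hs)^[N] x : ℝ) - ((tentMap s hs)^[N] origin : ℝ)| = s ^ N * |(x : ℝ)| := by
  induction N with
  | zero => simp
  | succ N ih =>
    have ih' := ih fun i h1 h2 => hx i h1 (by omega)
    have key : ∀ a b : ℝ, 0 < a * b ∨ b = 0 → |(|b| - |a|)| = |a - b| := by
      intro a b hab
      rcases hab with hab | rfl
      · rcases pos_and_pos_or_neg_and_neg_of_mul_pos hab with ⟨ha, hb⟩ | ⟨ha, hb⟩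
        · rw [abs_of_pos ha, abs_of_pos hb, abs_sub_comm]
        · rw [abs_of_neg ha, abs_of_neg hb]; congr 1; ring
      · simp
    rw [Function.iterate_succ_apply', Function.iterate_succ_apply', coe_tentMap, coe_tentMap]
    have h0 : ∀ a b : ℝ, s * (1 - |a|) - 1 - (s * (1 - |b|) - 1) = s * (|b| - |a|) := by
      intros; ring
    rw [h0, abs_mul, abs_of_pos hs.1, key, ih', pow_succ]
    · ring
    · rcases Nat.eq_zero_or_pos N with rfl | hN
      · right; simp
      · left; exact hx N hN (Nat.lt_succ_self N)

theorem abs_le_of_iterate_tentMap (s : ℝ) (hs : s ∈ Ioc (0 : ℝ) 2) (x : SymmIcc) (N : ℕ)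
    (hx : ∀ i, 1 ≤ i → i < N →
      0 < ((tentMap s hs)^[i] x : ℝ) * ((tentMap s hs)^[i] origin : ℝ)) :
    |(x : ℝ)| ≤ 2 / s ^ N := by
  have h := abs_iterate_tentMap_sub s hs x N hx
  rw [le_div_iff₀ (pow_pos hs.1 N), mul_comm, ← h, abs_le]
  have h1 := ((tentMap s hs)^[N] x).2
  have h2 := ((tentMap s hs)^[N] origin).2
  constructor <;> linarith [h1.1, h1.2, h2.1, h2.2]

theorem finite_iterate_tentMap_preimage (s : ℝ) (hs : s ∈ Ioc (0 : ℝ) 2) (n : ℕ) (y : SymmIcc) :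
    ((tentMap s hs)^[n] ⁻¹' {y}).Finite := by
  have h1 : ∀ y, (tentMap s hs ⁻¹' {y}).Finite := by
    intro y
    refine Set.Finite.of_finite_image (f := ((↑) : SymmIcc → ℝ)) ?_ Subtype.val_injective.injOn
    refine (Set.toFinite {1 - ((y : ℝ) + 1) / s, -(1 - ((y : ℝ) + 1) / s)}).subset ?_
    rintro _ ⟨x, hx, rfl⟩
    have hx' : s * (1 - |(x : ℝ)|) - 1 = y := by
      rw [← coe_tentMap s hs]; exact congrArg _ hx
    have h3 : |(x : ℝ)| = 1 - ((y : ℝ) + 1) / s := by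
      field_simp [hs.1.ne']; linarith
    rcases abs_choice (x : ℝ) with h | h <;> rw [h] at h3
    · left; exact h3
    · right; simp only [mem_singleton_iff]; linarith
  induction n generalizing y with
  | zero => simp
  | succ n ih =>
    rw [Function.iterate_succ', Set.preimage_comp]
    exact (h1 y).preimage' fun b _ => ih b

instance neBot_nhdsGT_origin : (𝓝[>] origin).NeBot :=
  nhdsGT_neBot_of_exists_gt ⟨⟨1, by norm_num, by norm_num⟩, by
    rw [← Subtype.coe_lt_coe]; norm_num⟩

theorem eventually_iterate_ne_origin (s : ℝ) (hs : s ∈ Ioc (0 : ℝ) 2) (n : ℕ) :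
    ∀ᶠ y in 𝓝[>] origin, (tentMap s hs)^[n] y ≠ origin := by
  have h := (finite_iterate_tentMap_preimage s hs n origin).sdiff (t := {origin})
  have h2 : ((tentMap s hs)^[n] ⁻¹' {origin} \ {origin})ᶜ ∈ 𝓝 origin :=
    h.isClosed.isOpen_compl.mem_nhds (by simp)
  filter_upwards [mem_nhdsWithin_of_mem_nhds h2, self_mem_nhdsWithin] with y hy hpos hc
  exact hy ⟨hc, hpos.ne'⟩

/-! ### The orbit of the turning point -/

/-- If the turning point returns to itself after `p` steps, the kneading invariant has period `p`:
on one side of `0` the `p`-th iterate is close to `0`, and the tent map does not see its sign. -/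
theorem periodic_of_iterate_origin_eq {s : ℝ} {hs : s ∈ Ioc (0 : ℝ) 2} {e : ℕ → Symbol}
    (he : IsKneadingInvariant (tentMap s hs) origin e) {p : ℕ}
    (hp : (tentMap s hs)^[p] origin = origin) (j : ℕ) (hj : 1 ≤ j) : e (p + j) = e j := by
  set T := tentMap s hs with hT
  -- Since `T |x| = T x`, composing `T^[p]` with `A x = |x|` brings it to the right of `0`.
  let A : SymmIcc → SymmIcc := fun x =>
    ⟨|(x : ℝ)|, by linarith [abs_nonneg (x : ℝ)], abs_le.2 x.2⟩
  have hA : Continuous A := Continuous.subtype_mk (by fun_prop) _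
  have hA0 : A origin = origin := Subtype.ext (by simp [A])
  have hTA : ∀ x, T (A x) = T x := fun x => Subtype.ext (by simp [hT, coe_tentMap, A])
  have hlim : Tendsto (fun y => A (T^[p] y)) (𝓝[>] origin) (𝓝[>] origin) := by
    refine tendsto_nhdsWithin_iff.2 ⟨?_, ?_⟩
    · have : Continuous fun y => A (T^[p] y) := hA.comp ((continuous_tentMap s hs).iterate p)
      have h2 := this.tendsto origin
      simp only [hp, hA0] at h2
      exact h2.mono_left nhdsWithin_le_nhds
    · filter_upwards [eventually_iterate_ne_origin s hs p] with y hy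
      rw [mem_Ioi, ← Subtype.coe_lt_coe]
      exact abs_pos.2 (ne_origin_iff.1 hy)
  have h1 := hlim.eventually (he j hj)
  have h2 := he (p + j) (by omega)
  obtain ⟨y, hy1, hy2⟩ := (h1.and h2).exists
  rw [← hy1, ← hy2]
  have h3 : T^[j] (A (T^[p] y)) = T^[p + j] y := by
    obtain ⟨i, rfl⟩ : ∃ i, j = i + 1 := ⟨j - 1, by omega⟩
    rw [Function.iterate_succ_apply, hTA, ← Function.iterate_succ_apply,
      ← Function.iterate_add_apply, Nat.add_comm]
  simp only [itinerary, h3]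

theorem kneading_ne_turn {s : ℝ} {hs : s ∈ Ioc (0 : ℝ) 2} {e : ℕ → Symbol}
    (he : IsKneadingInvariant (tentMap s hs) origin e) {j : ℕ} (hj : 1 ≤ j) : e j ≠ .turn := by
  obtain ⟨y, hy1, hy2⟩ := ((he j hj).and (eventually_iterate_ne_origin s hs j)).exists
  rw [← hy1]
  rcases lt_or_gt_of_ne hy2 with h | h
  · simp [itinerary, h]
  · simp [itinerary, h, h.not_gt]

theorem itinerary_origin_eq {s : ℝ} {hs : s ∈ Ioc (0 : ℝ) 2} {e : ℕ → Symbol}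
    (he : IsKneadingInvariant (tentMap s hs) origin e) {j : ℕ} (hj : 1 ≤ j)
    (hne : (tentMap s hs)^[j] origin ≠ origin) :
    itinerary (tentMap s hs) origin origin j = e j := by
  have hc : Tendsto (tentMap s hs)^[j] (𝓝[>] origin) (𝓝 ((tentMap s hs)^[j] origin)) :=
    (((continuous_tentMap s hs).iterate j).tendsto origin).mono_left nhdsWithin_le_nhds
  rcases lt_or_gt_of_ne hne with h | h
  · obtain ⟨y, hy1, hy2⟩ := ((he j hj).and (hc.eventually (gt_mem_nhds h))).exists
    rw [← hy1]; simp [itinerary, h, hy2]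
  · obtain ⟨y, hy1, hy2⟩ := ((he j hj).and (hc.eventually (lt_mem_nhds h))).exists
    rw [← hy1]; simp [itinerary, h, hy2, h.not_gt, hy2.not_gt]

theorem mul_pos_of_itinerary_eq {g : SymmIcc → SymmIcc} {x y : SymmIcc} {m n : ℕ}
    (h : itinerary g origin x m = itinerary g origin y n) (hy : g^[n] y ≠ origin) :
    0 < (g^[m] x : ℝ) * (g^[n] y : ℝ) := by
  have hlt : ∀ z : SymmIcc, z < origin ↔ (z : ℝ) < 0 := fun z => Iff.rfl
  have hgt : ∀ z : SymmIcc, origin < z ↔ 0 < (z : ℝ) := fun z => Iff.rfl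
  simp only [itinerary] at h
  rcases lt_or_gt_of_ne hy with h1 | h1
  · rw [if_pos h1] at h
    split_ifs at h with h2
    exact mul_pos_of_neg_of_neg h2 h1
  · rw [if_neg h1.not_gt, if_pos h1] at h
    split_ifs at h with h2 h3
    exact mul_pos h3 h1

/-- The consequences of Fibonacci recurrence that matter here: the slope exceeds `1`, the turning
point is not periodic, and every stretch of `S (k + 1) + 1` consecutive points of its orbit contains
one at distance at most `2 / s ^ S k` from the turning point. -/
theorem HasFibonacciRecurrence.close_returns {s : ℝ} {hs : s ∈ Ioc (0 : ℝ) 2}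
    (hfib : HasFibonacciRecurrence (tentMap s hs) origin) :
    1 < s ∧ (∀ p, 1 ≤ p → (tentMap s hs)^[p] origin ≠ origin) ∧
    ∃ S : ℕ → ℕ, StrictMono S ∧ (∀ k, S (k + 1) ≤ 2 * S k) ∧
      ∀ k n, ∃ j ≤ S (k + 1), |((tentMap s hs)^[n + j] origin : ℝ)| ≤ 2 / s ^ S k := by
  obtain ⟨-, S, e, hS0, hS, he, he1, hQ⟩ := hfib
  have hadd : ∀ k, S (k + 2) = S (k + 1) + S k := fun k => hS (k + 2) (by omega)
  have hS1 : S 1 = 2 := by have := hS 1 le_rfl; simp [hS0] at this; exact this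
  have hpos : ∀ k, 1 ≤ S k ∧ S k < S (k + 1) ∧ S (k + 1) ≤ 2 * S k := by
    intro k
    induction k with
    | zero => simp [hS0, hS1]
    | succ k ih =>
      have h : S (k + 1 + 1) = S (k + 1) + S k := hadd k
      omega
  have hmono : StrictMono S := strictMono_nat_of_lt_succ fun k => (hpos k).2.1
  have hblock : ∀ k i, 1 ≤ i → i < S k → e (S (k + 1) + i) = e i := fun k =>
    (hQ (k + 2) (by omega)).1
  have hmis : ∀ k, e (S (k + 1) + S k) ≠ e (S k) := by
    intro k
    have h1 : e (S (k + 1) + S k) = (e (S k)).flip := (hQ (k + 2) (by omega)).2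
    have h2 := kneading_ne_turn he (hpos k).1
    rw [h1]
    cases h : e (S k) <;> simp_all [Symbol.flip]
  have hnp : ∀ p, 1 ≤ p → (tentMap s hs)^[p] origin ≠ origin := fun p hp h =>
    not_periodic_of_mismatch hmono hblock hmis hp (periodic_of_iterate_origin_eq he h)
  refine ⟨?_, hnp, S, hmono, fun k => (hpos k).2.2, ?_⟩
  · have h := itinerary_origin_eq he le_rfl (hnp 1 le_rfl)
    rw [he1] at h
    simp only [itinerary] at h
    split_ifs at h with h1 h2
    have h3 : (0 : ℝ) < (tentMap s hs origin : ℝ) := h2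
    rw [coe_tentMap] at h3
    simp at h3
    exact h3
  · intro k n
    have hlt : n + S (k + 1) < S (n + S (k + 1) + 1 + k) := by
      have := hmono.id_le (n + S (k + 1) + 1 + k)
      simp only [id] at this; omega
    obtain ⟨p, h1, h2, -, h4⟩ := exists_recurrence_time_le hmono hadd hblock k _ _ hlt
    refine ⟨p - n, by omega, ?_⟩
    rw [show n + (p - n) = p by omega]
    refine abs_le_of_iterate_tentMap s hs _ _ fun i hi hik => ?_
    rw [← Function.iterate_add_apply, Nat.add_comm i p]
    refine mul_pos_of_itinerary_eq ?_ (hnp i hi)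
    rw [itinerary_origin_eq he (by omega) (hnp _ (by omega)), itinerary_origin_eq he hi (hnp _ hi),
      h4 i hi hik]

/-! ### Mass near the turning point -/

theorem isClosed_abs_le (r : ℝ) : IsClosed {x : SymmIcc | |(x : ℝ)| ≤ r} :=
  isClosed_le (by fun_prop) continuous_const

theorem isOpen_ne_zero_and_abs_lt (r : ℝ) :
    IsOpen {x : SymmIcc | (x : ℝ) ≠ 0 ∧ |(x : ℝ)| < r} :=
  (isOpen_ne_fun continuous_subtype_val continuous_const).inter
    (isOpen_lt (continuous_abs.comp continuous_subtype_val) continuous_const)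

/-- An invariant probability measure carried by the closure of the orbit of `0` gives mass at least
`1 / (N + 1)` to any `[-r, r]` which the orbit visits once in every `N + 1` consecutive steps: the
preimages of `[-r, r]` of orders `0, …, N` cover the orbit, hence its closure. -/
theorem one_le_mul_measure_of_returns {g : SymmIcc → SymmIcc} (hg : Continuous g)
    {μ : Measure SymmIcc} [IsProbabilityMeasure μ] (hμ : MeasurePreserving g μ μ)
    {x : SymmIcc} (hsupp : μ (closure (orbit g x))ᶜ = 0) {N : ℕ} {r : ℝ}
    (hr : ∀ n, ∃ j ≤ N, |(g^[n + j] x : ℝ)| ≤ r) :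
    1 ≤ ((N : ℝ≥0∞) + 1) * μ {x : SymmIcc | |(x : ℝ)| ≤ r} := by
  set B := {x : SymmIcc | |(x : ℝ)| ≤ r}
  have hB : IsClosed B := isClosed_abs_le r
  set U := ⋃ j ∈ Finset.range (N + 1), g^[j] ⁻¹' B
  have hU : IsClosed U := isClosed_biUnion_finset fun j _ => hB.preimage (hg.iterate j)
  have hsub : closure (orbit g x) ⊆ U := by
    refine closure_minimal ?_ hU
    rintro _ ⟨n, rfl⟩
    obtain ⟨j, hj, hjr⟩ := hr n
    refine mem_biUnion (Finset.mem_coe.2 (Finset.mem_range.2 (Nat.lt_succ_of_le hj))) ?_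
    rw [mem_preimage, ← Function.iterate_add_apply, Nat.add_comm]
    exact hjr
  have h1 : μ U = 1 :=
    (prob_compl_eq_zero_iff hU.measurableSet).1
      (measure_mono_null (compl_subset_compl.2 hsub) hsupp)
  calc 1 = μ U := h1.symm
    _ ≤ ∑ j ∈ Finset.range (N + 1), μ (g^[j] ⁻¹' B) := measure_biUnion_finset_le _ _
    _ = ∑ j ∈ Finset.range (N + 1), μ B := Finset.sum_congr rfl fun j _ =>
        (hμ.iterate j).measure_preimage hB.measurableSet.nullMeasurableSet
    _ = ((N : ℝ≥0∞) + 1) * μ B := by simp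

/-- By Poincaré recurrence, a point which never returns to itself has measure zero. -/
theorem measure_singleton_eq_zero_of_not_periodic {g : SymmIcc → SymmIcc}
    {μ : Measure SymmIcc} [IsProbabilityMeasure μ] (hμ : MeasurePreserving g μ μ)
    {x : SymmIcc} (hx : ∀ p, 1 ≤ p → g^[p] x ≠ x) : μ {x} = 0 := by
  by_contra h
  obtain ⟨y, rfl, m, hm, hy⟩ := hμ.conservative.exists_mem_iterate_mem
    (measurableSet_singleton x).nullMeasurableSet h
  exact hx m (Nat.one_le_iff_ne_zero.2 hm) hy

/-- Suppose that `[-r, r]`, with `r = 2 / s ^ S k`, has mass at least of the order of `1 / S k`.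
Then a function dominating a multiple of `-log |x|` near `0` has infinite integral: its integral
over `[-r, r]` is at least of the order of `S k * (1 / S k)`, whereas it would tend to zero if the
function were integrable. -/
theorem lintegral_eq_top_of_log_le {μ : Measure SymmIcc} [IsProbabilityMeasure μ]
    (hμ0 : μ {origin} = 0) {s : ℝ} (hs : 1 < s) {S : ℕ → ℕ} (hS : StrictMono S)
    (hS2 : ∀ k, S (k + 1) ≤ 2 * S k)
    (hmass : ∀ k, 1 ≤ ((S (k + 1) : ℝ≥0∞) + 1) * μ {x : SymmIcc | |(x : ℝ)| ≤ 2 / s ^ S k})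
    {g : SymmIcc → ℝ≥0∞} {a C δ : ℝ} (ha : 0 < a) (hδ : 0 < δ)
    (hg : ∀ x : SymmIcc, (x : ℝ) ≠ 0 → |(x : ℝ)| < δ →
      ENNReal.ofReal (a * -Real.log |(x : ℝ)| - C) ≤ g x) :
    ∫⁻ x, g x ∂μ = ⊤ := by
  by_contra hfin
  set B : ℕ → Set SymmIcc := fun k => {x : SymmIcc | |(x : ℝ)| ≤ 2 / s ^ S k} with hBdef
  have hs0 : 0 < s := one_pos.trans hs
  have hlog : 0 < Real.log s := Real.log_pos hs
  have hSt : Tendsto S atTop atTop := hS.tendsto_atTop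
  have hrad : Tendsto (fun k => 2 / s ^ S k) atTop (𝓝 0) :=
    ((tendsto_pow_atTop_atTop_of_one_lt hs).comp hSt).const_div_atTop 2
  have hBm : ∀ k, MeasurableSet (B k) := fun k => (isClosed_abs_le _).measurableSet
  have hanti : Antitone B := by
    intro k l hkl x hx
    refine le_trans hx (div_le_div_of_nonneg_left (by norm_num) (pow_pos hs0 _) ?_)
    exact pow_le_pow_right₀ hs.le (hS.monotone hkl)
  have hinter : ⋂ k, B k = {origin} := by
    ext x
    simp only [mem_iInter, mem_singleton_iff]
    constructor
    · intro h
      have h0 : |(x : ℝ)| ≤ 0 := ge_of_tendsto' hrad h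
      exact Subtype.ext (abs_nonpos_iff.1 h0)
    · rintro rfl k
      simp only [hBdef, mem_ofPred_eq, coe_origin, abs_zero]
      positivity
  have hμB : Tendsto (μ ∘ B) atTop (𝓝 0) := by
    have h := tendsto_measure_iInter_atTop (μ := μ) (fun k => (hBm k).nullMeasurableSet) hanti
      ⟨0, measure_ne_top _ _⟩
    rwa [hinter, hμ0] at h
  have hint := tendsto_setLIntegral_zero hfin hμB
  -- On `B k` the lower bound for `g` is at least `2 * b * S k - a * log 2 - C`; half of the leading
  -- term absorbs the constants once `k` is large.
  set b := a * Real.log s / 2 with hb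
  have hb0 : 0 < b := by positivity
  have hSr : Tendsto (fun k => b * (S k : ℝ)) atTop atTop :=
    (tendsto_natCast_atTop_atTop.comp hSt).const_mul_atTop hb0
  have hlow : ∀ᶠ k in atTop, ENNReal.ofReal (b / 3) ≤ ∫⁻ x in B k, g x ∂μ := by
    filter_upwards [hrad.eventually (gt_mem_nhds hδ),
      hSr.eventually (eventually_ge_atTop (a * Real.log 2 + C)), eventually_ge_atTop 1]
      with k hk1 hk2 hk3
    have hSk : 1 ≤ S k := le_trans hk3 (hS.id_le k)
    have hpt : ∀ x ∈ B k \ {origin}, ENNReal.ofReal (b * S k) ≤ g x := by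
      rintro x ⟨hxB, hx0⟩
      have hx0' : (x : ℝ) ≠ 0 := ne_origin_iff.1 hx0
      refine le_trans (ENNReal.ofReal_le_ofReal ?_) (hg x hx0' (lt_of_le_of_lt hxB hk1))
      have h1 : Real.log |(x : ℝ)| ≤ Real.log 2 - S k * Real.log s := by
        rw [← Real.log_pow, ← Real.log_div (by norm_num) (pow_pos hs0 _).ne']
        exact Real.log_le_log (abs_pos.2 hx0') hxB
      have h2 : a * (S k * Real.log s - Real.log 2) ≤ a * -Real.log |(x : ℝ)| :=
        mul_le_mul_of_nonneg_left (by linarith) ha.le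
      have h3 : a * (S k * Real.log s) = 2 * (b * S k) := by rw [hb]; ring
      rw [mul_sub, h3] at h2
      linarith
    calc ENNReal.ofReal (b / 3)
        ≤ ENNReal.ofReal (b / 3) * (((S (k + 1) : ℝ≥0∞) + 1) * μ (B k)) :=
          le_mul_of_one_le_right' (hmass k)
      _ ≤ ENNReal.ofReal (b * S k) * μ (B k) := by
          rw [← mul_assoc]
          gcongr
          have h3 : ((S (k + 1) : ℝ≥0∞) + 1) = ENNReal.ofReal ((S (k + 1) : ℝ) + 1) := by
            rw [ENNReal.ofReal_add (by positivity) zero_le_one]; simp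
          rw [h3, ← ENNReal.ofReal_mul (by positivity)]
          refine ENNReal.ofReal_le_ofReal ?_
          have h4 : ((S (k + 1) : ℝ) + 1) ≤ 3 * S k := by
            have := hS2 k
            exact_mod_cast (by omega : S (k + 1) + 1 ≤ 3 * S k)
          nlinarith
      _ = ∫⁻ _ in B k \ {origin}, ENNReal.ofReal (b * S k) ∂μ := by
          rw [setLIntegral_const, measure_sdiff_null hμ0]
      _ ≤ ∫⁻ x in B k \ {origin}, g x ∂μ :=
          setLIntegral_mono' ((hBm k).diff (measurableSet_singleton _)) hpt
      _ ≤ ∫⁻ x in B k, g x ∂μ := lintegral_mono_set sdiff_subset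
  have := ge_of_tendsto hint hlow
  simp only [nonpos_iff_eq_zero, ENNReal.ofReal_eq_zero] at this
  linarith

end SymmIcc

/-! ### Derivatives of self-maps of the interval -/

theorem HasDerivWithinAt.of_left_inverse_within {F G : ℝ → ℝ} {d a : ℝ} {s t : Set ℝ}
    (hG : Tendsto G (𝓝[s] a) (𝓝[t] (G a))) (hF : HasDerivWithinAt F d t (G a)) (hd : d ≠ 0)
    (ha : a ∈ s) (hFG : ∀ᶠ x in 𝓝[s] a, F (G x) = x) : HasDerivWithinAt G d⁻¹ s a := by
  have hE : (ContinuousLinearEquiv.unitsEquivAut ℝ (Units.mk0 d hd) : ℝ →L[ℝ] ℝ) =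
      ContinuousLinearMap.toSpanSingleton ℝ d := by
    ext; simp
  have h1 : HasFDerivWithinAt F
      (ContinuousLinearEquiv.unitsEquivAut ℝ (Units.mk0 d hd) : ℝ →L[ℝ] ℝ) t (G a) := by
    rw [hE]; exact hF.hasFDerivWithinAt
  have h2 := (HasFDerivWithinAt.of_local_left_inverse hG h1 ha hFG).hasDerivWithinAt
  have h3 : ((ContinuousLinearEquiv.unitsEquivAut ℝ (Units.mk0 d hd)).symm : ℝ →L[ℝ] ℝ) 1 =
      d⁻¹ := by
    rw [ContinuousLinearEquiv.coe_coe, ContinuousLinearEquiv.symm_apply_eq]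
    simp [hd]
  rwa [h3] at h2

namespace SymmIcc

theorem toReal_coe (g : SymmIcc → SymmIcc) (x : SymmIcc) : toReal g x = g x :=
  Set.IccExtend_val _ _ x

theorem toReal_comp (g₁ g₂ : SymmIcc → SymmIcc) : toReal (g₁ ∘ g₂) = toReal g₁ ∘ toReal g₂ := by
  funext z
  exact (toReal_coe g₁ (g₂ (projIcc (-1) 1 (by norm_num) z))).symm

theorem mapsTo_toReal (g : SymmIcc → SymmIcc) (s : Set ℝ) : MapsTo (toReal g) s (Icc (-1) 1) :=
  fun z _ => (g (projIcc (-1) 1 (by norm_num) z)).2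

theorem uniqueDiff (x : SymmIcc) : UniqueDiffWithinAt ℝ (Icc (-1 : ℝ) 1) x :=
  uniqueDiffOn_Icc (by norm_num) x x.2

theorem hasDerivWithinAt_toReal_comp {g₁ g₂ : SymmIcc → SymmIcc} {x : SymmIcc} {d₁ d₂ : ℝ}
    (h₁ : HasDerivWithinAt (toReal g₁) d₁ (Icc (-1) 1) (g₂ x : ℝ))
    (h₂ : HasDerivWithinAt (toReal g₂) d₂ (Icc (-1) 1) x) :
    HasDerivWithinAt (toReal (g₁ ∘ g₂)) (d₁ * d₂) (Icc (-1) 1) x := by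
  rw [toReal_comp]
  rw [← toReal_coe] at h₁
  exact h₁.comp _ h₂ (mapsTo_toReal g₂ _)

theorem hasDerivWithinAt_toReal_symm {h : SymmIcc ≃ₜ SymmIcc} {x : SymmIcc} {d : ℝ} (hd : d ≠ 0)
    (hx : HasDerivWithinAt (toReal h) d (Icc (-1) 1) x) :
    HasDerivWithinAt (toReal h.symm) d⁻¹ (Icc (-1) 1) (h x : ℝ) := by
  have hG : toReal h.symm (h x : ℝ) = x := by rw [toReal_coe, h.symm_apply_apply]
  refine HasDerivWithinAt.of_left_inverse_within (F := toReal h) ?_ (by rwa [hG]) hd (h x).2 ?_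
  · refine tendsto_nhdsWithin_iff.2 ⟨?_, Eventually.of_forall fun z => mapsTo_toReal _ univ trivial⟩
    have hc : Continuous (toReal h.symm) :=
      (continuous_subtype_val.comp h.symm.continuous).Icc_extend'
    exact hc.continuousAt.tendsto.mono_left nhdsWithin_le_nhds
  · filter_upwards [self_mem_nhdsWithin] with z hz
    have h1 := toReal_coe h.symm ⟨z, hz⟩
    simp only at h1
    rw [h1, toReal_coe, h.apply_symm_apply]

/-- Away from `0` the tent map has a derivative `± s`. -/
theorem exists_hasDerivWithinAt_tentMap (s : ℝ) (hs : s ∈ Ioc (0 : ℝ) 2) {x : SymmIcc}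
    (hx : (x : ℝ) ≠ 0) :
    ∃ d, |d| = s ∧ HasDerivWithinAt (toReal (tentMap s hs)) d (Icc (-1) 1) x := by
  refine ⟨s * -(SignType.sign (x : ℝ) : ℝ), ?_, ?_⟩
  · rw [abs_mul, abs_of_pos hs.1, abs_neg]
    rcases lt_or_gt_of_ne hx with h | h <;> simp [h]
  · have h1 : HasDerivAt (fun t : ℝ => s * (1 - |t|) - 1) (s * -(SignType.sign (x : ℝ) : ℝ)) x :=
      (((hasDerivAt_abs hx).const_sub 1).const_mul s).sub_const 1
    refine h1.hasDerivWithinAt.congr_of_mem (fun z hz => ?_) x.2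
    exact toReal_coe (tentMap s hs) ⟨z, hz⟩

/-! ### Admissible homeomorphisms -/

variable {h : SymmIcc ≃ₜ SymmIcc}

theorem IsAdmissible.hasDerivWithinAt (hh : IsAdmissible h) (x : SymmIcc) :
    HasDerivWithinAt (toReal h) (derivAt h x) (Icc (-1) 1) x := by
  refine DifferentiableWithinAt.hasDerivWithinAt ?_
  by_cases hx : (x : ℝ) = 0
  · have h0 : x ∈ critSet h := by rw [hh.crit]; exact Subtype.ext hx
    exact HasDerivWithinAt.differentiableWithinAt h0
  · refine (hh.analytic x ⟨x.2, hx⟩).differentiableWithinAt.mono_of_mem_nhdsWithin ?_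
    exact mem_of_superset (inter_mem self_mem_nhdsWithin
      (mem_nhdsWithin_of_mem_nhds (isOpen_compl_singleton.mem_nhds hx))) (subset_insert _ _)

theorem IsAdmissible.derivAt_ne_zero (hh : IsAdmissible h) {x : SymmIcc} (hx : (x : ℝ) ≠ 0) :
    derivAt h x ≠ 0 := by
  intro h0
  have h1 := hh.hasDerivWithinAt x
  rw [h0] at h1
  have h2 : x ∈ critSet h := h1
  rw [hh.crit] at h2
  exact hx (congrArg Subtype.val h2)

theorem IsAdmissible.continuousOn_derivAt (hh : IsAdmissible h) :
    ContinuousOn (derivAt h) {x : SymmIcc | (x : ℝ) ≠ 0} := by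
  have hopen : IsOpen ({0}ᶜ : Set ℝ) := isOpen_compl_singleton
  have hu : UniqueDiffOn ℝ (Icc (-1 : ℝ) 1 \ {0}) :=
    (uniqueDiffOn_Icc (by norm_num)).inter hopen
  have h1 : ContinuousOn (derivWithin (toReal h) (Icc (-1) 1 \ {0})) (Icc (-1) 1 \ {0}) :=
    (hh.analytic.contDiffOn (n := 1) hu).continuousOn_derivWithin hu le_rfl
  have h2 : ContinuousOn (derivWithin (toReal h) (Icc (-1) 1)) (Icc (-1) 1 \ {0}) :=
    h1.congr fun z hz => (derivWithin_inter (hopen.mem_nhds hz.2)).symm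
  exact h2.comp continuous_subtype_val.continuousOn fun x hx => ⟨x.2, hx⟩

theorem IsAdmissible.exists_le_abs_derivAt (hh : IsAdmissible h) {ε : ℝ} (hε : 0 < ε) :
    ∃ m > 0, ∀ x : SymmIcc, ε ≤ |(x : ℝ)| → m ≤ |derivAt h x| := by
  have hK : IsCompact {x : SymmIcc | ε ≤ |(x : ℝ)|} :=
    (isClosed_le continuous_const (by fun_prop)).isCompact
  have hne : ∀ x : SymmIcc, ε ≤ |(x : ℝ)| → (x : ℝ) ≠ 0 := fun x hx =>
    abs_pos.1 (hε.trans_le hx)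
  rcases {x : SymmIcc | ε ≤ |(x : ℝ)|}.eq_empty_or_nonempty with h0 | h0
  · exact ⟨1, one_pos, fun x hx => absurd (show x ∈ {x : SymmIcc | ε ≤ |(x : ℝ)|} from hx)
      (by rw [h0]; exact notMem_empty x)⟩
  · obtain ⟨y, hy, hmin⟩ := hK.exists_isMinOn h0 ((hh.continuousOn_derivAt.mono hne).abs)
    exact ⟨_, abs_pos.2 (hh.derivAt_ne_zero (hne y hy)), fun x hx => hmin hx⟩

/-- The upper bound for `|h'|` contained in non-flatness, with a common exponent on the two
sides. -/
theorem IsAdmissible.exists_log_abs_derivAt_le (hh : IsAdmissible h) :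
    ∃ a > 0, ∃ M, ∃ δ > 0, ∀ x : SymmIcc, (x : ℝ) ≠ 0 → |(x : ℝ)| < δ →
      Real.log |derivAt h x| ≤ M - a * -Real.log |(x : ℝ)| := by
  obtain ⟨-, αp, hp, αm, hm, M, -, δ, hδ, h1, h2⟩ := hh.nonFlat
  simp only [coe_origin, zero_add, zero_sub, sub_zero] at h1 h2
  have key : ∀ (x : SymmIcc) (α : ℝ), (x : ℝ) ≠ 0 → min αp αm ≤ α →
      |Real.log (|derivAt h x| / |(x : ℝ)| ^ α)| ≤ M →
      Real.log |derivAt h x| ≤ M - min αp αm * -Real.log |(x : ℝ)| := by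
    intro x α hx hα hb
    have hx' := abs_pos.2 hx
    rw [Real.log_div (abs_pos.2 (hh.derivAt_ne_zero hx)).ne' (Real.rpow_pos_of_pos hx' α).ne',
      Real.log_rpow hx'] at hb
    have h3 := (abs_le.1 hb).2
    have h4 : Real.log |(x : ℝ)| ≤ 0 := Real.log_nonpos hx'.le (abs_le.2 x.2)
    nlinarith
  refine ⟨min αp αm, lt_min hp hm, M, δ, hδ, fun x hx hxδ => ?_⟩
  -- As `log |x| ≤ 0`, the bound with the smaller exponent follows from either of the two.
  rcases lt_or_gt_of_ne hx with hneg | hpos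
  · exact key x αm hx (min_le_right _ _) (h2 x (by linarith [(abs_lt.1 hxδ).1]) hneg).2
  · exact key x αp hx (min_le_left _ _) (h1 x hpos (abs_lt.1 hxδ).2).2

theorem IsAdmissible.exists_dist_le (hh : IsAdmissible h) :
    ∃ δ > 0, ∀ x : SymmIcc, |(x : ℝ)| < δ → dist (h x) (h origin) ≤ |(x : ℝ)| := by
  have h0 : origin ∈ critSet h := by rw [hh.crit]; rfl
  have h1 := hasDerivWithinAt_iff_isLittleO.1 h0
  have h2 := h1.def one_pos
  rw [coe_origin, eventually_nhdsWithin_iff, Metric.eventually_nhds_iff] at h2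
  obtain ⟨δ, hδ, h3⟩ := h2
  refine ⟨δ, hδ, fun x hx => ?_⟩
  have h4 := h3 (y := (x : ℝ)) (by simpa using hx) x.2
  have h5 := toReal_coe h origin
  rw [coe_origin] at h5
  simpa [toReal_coe, h5, Subtype.dist_eq, Real.dist_eq] using h4

/-- The chain rule for `h ∘ T ∘ h⁻¹` at `h x`. -/
theorem IsAdmissible.abs_derivAt_conj (hh : IsAdmissible h) (s : ℝ) (hs : s ∈ Ioc (0 : ℝ) 2)
    {x : SymmIcc} (hx : (x : ℝ) ≠ 0) :
    |derivAt (conj h (tentMap s hs)) (h x)| =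
      |derivAt h (tentMap s hs x)| * s / |derivAt h x| := by
  obtain ⟨d, hd, hT⟩ := exists_hasDerivWithinAt_tentMap s hs hx
  have h1 := hasDerivWithinAt_toReal_symm (hh.derivAt_ne_zero hx) (hh.hasDerivWithinAt x)
  have h2 : HasDerivWithinAt (toReal (tentMap s hs ∘ h.symm)) (d * (derivAt h x)⁻¹)
      (Icc (-1) 1) (h x : ℝ) :=
    hasDerivWithinAt_toReal_comp (by rwa [h.symm_apply_apply]) h1
  have h3 : HasDerivWithinAt (toReal (conj h (tentMap s hs)))
      (derivAt h (tentMap s hs x) * (d * (derivAt h x)⁻¹)) (Icc (-1) 1) (h x : ℝ) :=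
    hasDerivWithinAt_toReal_comp (g₂ := tentMap s hs ∘ h.symm)
      (by
        have := hh.hasDerivWithinAt (tentMap s hs x)
        rwa [Function.comp_apply, h.symm_apply_apply]) h2
  rw [derivAt, h3.derivWithin (uniqueDiff _), abs_mul, abs_mul, abs_inv, hd]
  ring

theorem IsAdmissible.derivAt_conj_ne_zero (hh : IsAdmissible h) (s : ℝ) (hs : s ∈ Ioc (0 : ℝ) 2)
    {x : SymmIcc} (hx : (x : ℝ) ≠ 0) (hT : (tentMap s hs x : ℝ) ≠ 0) :
    derivAt (conj h (tentMap s hs)) (h x) ≠ 0 := by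
  rw [← abs_pos, hh.abs_derivAt_conj s hs hx]
  exact div_pos (mul_pos (abs_pos.2 (hh.derivAt_ne_zero hT)) hs.1)
    (abs_pos.2 (hh.derivAt_ne_zero hx))

/-! ### Size of the derivative of the conjugate map -/

/-- Near the turning point the conjugate map has a pole-like derivative: its logarithm grows like
`-log |x|`, since `h'` vanishes at `0` and not at `T 0`. -/
theorem IsAdmissible.exists_le_log_abs_derivAt_conj (hh : IsAdmissible h) {s : ℝ}
    (hs : s ∈ Ioc (0 : ℝ) 2) (hs1 : 1 < s) :
    ∃ a > 0, ∃ C, ∃ δ > 0, ∀ x : SymmIcc, (x : ℝ) ≠ 0 → |(x : ℝ)| < δ →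
      derivAt (conj h (tentMap s hs)) (h x) ≠ 0 ∧ a * -Real.log |(x : ℝ)| - C ≤
        Real.log |derivAt (conj h (tentMap s hs)) (h x)| := by
  obtain ⟨a, ha, M, δ, hδ, hup⟩ := hh.exists_log_abs_derivAt_le
  obtain ⟨m, hm, hlow⟩ := hh.exists_le_abs_derivAt (ε := (s - 1) / 2) (by linarith)
  have hs0 := hs.1
  refine ⟨a, ha, M - Real.log s - Real.log m, min δ ((s - 1) / (2 * s)),
    lt_min hδ (div_pos (by linarith) (by linarith)), fun x hx hxδ => ?_⟩
  have hT : (s - 1) / 2 ≤ |(tentMap s hs x : ℝ)| := by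
    have h1 := hxδ.trans_le (min_le_right _ _)
    rw [lt_div_iff₀ (by linarith)] at h1
    rw [coe_tentMap]
    exact le_trans (by nlinarith) (le_abs_self _)
  have hd := hlow _ hT
  refine ⟨hh.derivAt_conj_ne_zero s hs hx (abs_pos.1 (lt_of_lt_of_le (by linarith) hT)), ?_⟩
  have hx1 := abs_pos.2 (hh.derivAt_ne_zero hx)
  rw [hh.abs_derivAt_conj s hs hx, Real.log_div (mul_pos (hm.trans_le hd) hs0).ne' hx1.ne',
    Real.log_mul (hm.trans_le hd).ne' hs0.ne']
  have h4 := hup x hx (hxδ.trans_le (min_le_left _ _))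
  have h5 := Real.log_le_log hm hd
  linarith

/-- Near the preimages of the turning point, the logarithm of the derivative of the conjugate map
tends to `-∞` like `log |T x|`, since `h'` vanishes at `0` and not at these preimages. -/
theorem IsAdmissible.exists_log_abs_derivAt_conj_le (hh : IsAdmissible h) {s : ℝ}
    (hs : s ∈ Ioc (0 : ℝ) 2) (hs1 : 1 < s) :
    ∃ a > 0, ∃ C, ∃ δ > 0, ∀ x : SymmIcc, (tentMap s hs x : ℝ) ≠ 0 →
      |(tentMap s hs x : ℝ)| < δ →
      derivAt (conj h (tentMap s hs)) (h x) ≠ 0 ∧ a * -Real.log |(tentMap s hs x : ℝ)| - C ≤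
        -Real.log |derivAt (conj h (tentMap s hs)) (h x)| := by
  obtain ⟨a, ha, M, δ, hδ, hup⟩ := hh.exists_log_abs_derivAt_le
  have hs0 := hs.1
  have hε : 0 < (s - 1) / (2 * s) := div_pos (by linarith) (by linarith)
  obtain ⟨m, hm, hlow⟩ := hh.exists_le_abs_derivAt hε
  refine ⟨a, ha, M + Real.log s - Real.log m, min δ ((s - 1) / 2),
    lt_min hδ (by linarith), fun x hTx hxδ => ?_⟩
  have hx : (s - 1) / (2 * s) ≤ |(x : ℝ)| := by
    have h1 := (abs_lt.1 (hxδ.trans_le (min_le_right _ _))).2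
    rw [coe_tentMap] at h1
    rw [div_le_iff₀ (by linarith)]
    nlinarith
  have hd := hlow _ hx
  refine ⟨hh.derivAt_conj_ne_zero s hs (abs_pos.1 (hε.trans_le hx)) hTx, ?_⟩
  have hT1 := abs_pos.2 (hh.derivAt_ne_zero hTx)
  rw [hh.abs_derivAt_conj s hs (abs_pos.1 (hε.trans_le hx)),
    Real.log_div (mul_pos hT1 hs0).ne' (hm.trans_le hd).ne',
    Real.log_mul hT1.ne' hs0.ne']
  have h4 := hup _ hTx (hxδ.trans_le (min_le_left _ _))
  have h5 := Real.log_le_log hm hd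
  linarith

/-- The turning point is isolated in the singular set: at other nearby points the chain rule
gives a nonzero derivative. -/
theorem IsAdmissible.exists_infDist_singSet_pos (hh : IsAdmissible h) {s : ℝ}
    (hs : s ∈ Ioc (0 : ℝ) 2) (hs1 : 1 < s) :
    ∃ δ > 0, ∀ x : SymmIcc, (x : ℝ) ≠ 0 → |(x : ℝ)| < δ →
      0 < Metric.infDist (h x) (singSet (conj h (tentMap s hs)) (h origin)) := by
  refine ⟨(s - 1) / s, div_pos (by linarith) hs.1, fun x hx hxδ => ?_⟩
  refine (Metric.infDist_pos_iff_notMem_closure ⟨h origin, Or.inr rfl⟩).1 fun hcl => ?_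
  obtain ⟨_, ⟨z, ⟨hz0, hzδ⟩, rfl⟩, hz | hz⟩ :=
    mem_closure_iff.1 hcl _ (h.isOpenMap _ (isOpen_ne_zero_and_abs_lt ((s - 1) / s)))
      ⟨x, ⟨hx, hxδ⟩, rfl⟩
  · have hT : (tentMap s hs z : ℝ) ≠ 0 := by
      rw [lt_div_iff₀ hs.1] at hzδ
      rw [coe_tentMap]
      nlinarith
    exact hh.derivAt_conj_ne_zero s hs hz0 hT (HasDerivWithinAt.derivWithin hz (uniqueDiff _))
  · exact hz0 (congrArg Subtype.val (h.injective (mem_singleton_iff.1 hz)))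

theorem ofReal_le_toENNReal_logAbsDeriv {g : SymmIcc → SymmIcc} {x : SymmIcc} {r : ℝ}
    (hd : derivAt g x ≠ 0) (hr : r ≤ Real.log |derivAt g x|) :
    ENNReal.ofReal r ≤ (logAbsDeriv g x).toENNReal := by
  rw [logAbsDeriv, ENNReal.log_ofReal_of_pos (abs_pos.2 hd), EReal.real_coe_toENNReal]
  exact ENNReal.ofReal_le_ofReal hr

theorem ofReal_le_toENNReal_neg_logAbsDeriv {g : SymmIcc → SymmIcc} {x : SymmIcc} {r : ℝ}
    (hd : derivAt g x ≠ 0) (hr : r ≤ -Real.log |derivAt g x|) :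
    ENNReal.ofReal r ≤ (-logAbsDeriv g x).toENNReal := by
  rw [logAbsDeriv, ENNReal.log_ofReal_of_pos (abs_pos.2 hd), ← EReal.coe_neg,
    EReal.real_coe_toENNReal]
  exact ENNReal.ofReal_le_ofReal hr

end SymmIcc

/-! ### Divergence of the integrals -/

/-- Here `f' ` does not exist at the turning point `h 0`, so the integrals of `log |f'|` are
taken over the complement of that point. -/
theorem mainTheorem2
    (lam : ℝ) (hlam : lam ∈ Set.Ioc (0 : ℝ) 2)
    (hfib : SymmIcc.HasFibonacciRecurrence (SymmIcc.tentMap lam hlam) SymmIcc.origin)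
    (μ : Measure SymmIcc) [IsProbabilityMeasure μ]
    (hμ : Ergodic (SymmIcc.tentMap lam hlam) μ)
    (hsupp : μ (closure (SymmIcc.orbit (SymmIcc.tentMap lam hlam) SymmIcc.origin))ᶜ = 0)
    (h : SymmIcc ≃ₜ SymmIcc) (hh : SymmIcc.IsAdmissible h)
    (f : SymmIcc → SymmIcc) (hf : f = SymmIcc.conj h (SymmIcc.tentMap lam hlam))
    (c : SymmIcc) (hc : c = h SymmIcc.origin)
    (ν : Measure SymmIcc) (hν : ν = μ.map h) :
    SymmIcc.integralPos (SymmIcc.logAbsDeriv f) (ν.restrict {c}ᶜ) = ⊤ ∧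
    SymmIcc.integralNeg (SymmIcc.logAbsDeriv f) (ν.restrict {c}ᶜ) = ⊤ ∧
    ∫⁻ x, (SymmIcc.logDist (SymmIcc.singSet f c) x).abs ∂ν = ⊤ ∧
    ¬ SymmIcc.IntegralExists (SymmIcc.logAbsDeriv f) (ν.restrict {c}ᶜ) ∧
    ¬ Integrable (fun x => Real.log (Metric.infDist x (SymmIcc.singSet f c))) ν := by
  obtain ⟨hs1, hnp, S, hS, hS2, hret⟩ := hfib.close_returns
  have hμT := hμ.toMeasurePreserving
  have hμ0 := SymmIcc.measure_singleton_eq_zero_of_not_periodic hμT hnp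
  have hmass : ∀ k, 1 ≤ ((S (k + 1) : ℝ≥0∞) + 1) *
      μ {x : SymmIcc | |(x : ℝ)| ≤ 2 / lam ^ S k} := fun k =>
    SymmIcc.one_le_mul_measure_of_returns (SymmIcc.continuous_tentMap lam hlam) hμT hsupp (hret k)
  have hmap : ∀ F : SymmIcc → ℝ≥0∞, ∫⁻ y, F y ∂ν = ∫⁻ x, F (h x) ∂μ := fun F => by
    rw [hν]; exact lintegral_map_equiv F h.toMeasurableEquiv
  have hν0 : ν {c} = 0 := by
    have h1 : h ⁻¹' {h SymmIcc.origin} = {SymmIcc.origin} := by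
      ext x; simp
    rw [hν, hc, Measure.map_apply h.measurable (measurableSet_singleton _), h1, hμ0]
  have hrestr : ν.restrict {c}ᶜ = ν :=
    Measure.restrict_eq_self_of_ae_mem (compl_mem_ae_iff.2 hν0)
  rw [hrestr]
  have hdiv : ∀ {g : SymmIcc → ℝ≥0∞} {a C δ : ℝ}, 0 < a → 0 < δ →
      (∀ x : SymmIcc, (x : ℝ) ≠ 0 → |(x : ℝ)| < δ →
        ENNReal.ofReal (a * -Real.log |(x : ℝ)| - C) ≤ g x) → ∫⁻ x, g x ∂μ = ⊤ :=
    fun ha hδ hg => SymmIcc.lintegral_eq_top_of_log_le hμ0 hs1 hS hS2 hmass ha hδ hg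
  have hpos : SymmIcc.integralPos (SymmIcc.logAbsDeriv f) ν = ⊤ := by
    obtain ⟨a, ha, C, δ, hδ, hb⟩ := hh.exists_le_log_abs_derivAt_conj hlam hs1
    rw [SymmIcc.integralPos, hmap, hf]
    refine hdiv ha hδ (C := C) fun x hx hxδ => ?_
    obtain ⟨h1, h2⟩ := hb x hx hxδ
    exact SymmIcc.ofReal_le_toENNReal_logAbsDeriv h1 h2
  have hneg : SymmIcc.integralNeg (SymmIcc.logAbsDeriv f) ν = ⊤ := by
    obtain ⟨a, ha, C, δ, hδ, hb⟩ := hh.exists_log_abs_derivAt_conj_le hlam hs1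
    rw [SymmIcc.integralNeg, hmap, hf]
    -- The lower bound depends on `T x` only, so invariance moves its integral to the turning point.
    set V : Set SymmIcc := {x | (x : ℝ) ≠ 0 ∧ |(x : ℝ)| < δ} with hV
    have hVm : MeasurableSet V := (SymmIcc.isOpen_ne_zero_and_abs_lt δ).measurableSet
    set G : SymmIcc → ℝ≥0∞ :=
      V.indicator fun x => ENNReal.ofReal (a * -Real.log |(x : ℝ)| - C) with hG
    have hGm : Measurable G := by
      refine Measurable.indicator (ENNReal.measurable_ofReal.comp ?_) hVm
      have h1 : Measurable fun x : SymmIcc => |(x : ℝ)| :=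
        (continuous_abs.comp continuous_subtype_val).measurable
      exact ((Real.measurable_log.comp h1).neg.const_mul a).sub_const C
    have hGtop : ∫⁻ x, G x ∂μ = ⊤ := hdiv ha hδ (C := C) fun x hx hxδ => by
      rw [hG, indicator_of_mem (show x ∈ V from ⟨hx, hxδ⟩)]
    rw [← hμT.lintegral_comp hGm] at hGtop
    refine top_unique (hGtop.symm.le.trans (lintegral_mono fun x => ?_))
    by_cases hx : SymmIcc.tentMap lam hlam x ∈ V
    · simp only [hG, indicator_of_mem hx]
      obtain ⟨h1, h2⟩ := hb x hx.1 hx.2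
      exact SymmIcc.ofReal_le_toENNReal_neg_logAbsDeriv h1 h2
    · simp only [hG, indicator_of_notMem hx, zero_le]
  obtain ⟨δ₁, hδ₁, hle⟩ := hh.exists_dist_le
  obtain ⟨δ₂, hδ₂, hpd⟩ := hh.exists_infDist_singSet_pos hlam hs1
  have hcS : h SymmIcc.origin ∈ SymmIcc.singSet f c := Or.inr hc.symm
  have hdist : ∀ x : SymmIcc, (x : ℝ) ≠ 0 → |(x : ℝ)| < min δ₁ δ₂ →
      0 < Metric.infDist (h x) (SymmIcc.singSet f c) ∧
      ENNReal.ofReal (1 * -Real.log |(x : ℝ)| - 0) ≤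
        ENNReal.ofReal |Real.log (Metric.infDist (h x) (SymmIcc.singSet f c))| := by
    intro x hx hxδ
    have h1 := hpd x hx (hxδ.trans_le (min_le_right _ _))
    rw [← hf, ← hc] at h1
    refine ⟨h1, ENNReal.ofReal_le_ofReal ?_⟩
    have h2 : Metric.infDist (h x) (SymmIcc.singSet f c) ≤ |(x : ℝ)| :=
      (Metric.infDist_le_dist_of_mem hcS).trans
        (hle x (hxδ.trans_le (min_le_left _ _)))
    rw [one_mul, sub_zero]
    exact (neg_le_neg (Real.log_le_log h1 h2)).trans (neg_le_abs _)
  refine ⟨hpos, hneg, ?_, fun hex => hex.elim (· hpos) (· hneg), fun hint => ?_⟩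
  · rw [hmap]
    refine hdiv one_pos (lt_min hδ₁ hδ₂) (C := 0) fun x hx hxδ => ?_
    obtain ⟨h1, h2⟩ := hdist x hx hxδ
    rwa [SymmIcc.logDist, ENNReal.log_ofReal_of_pos h1, EReal.abs_def]
  · refine hint.hasFiniteIntegral.ne ?_
    rw [hmap]
    refine hdiv one_pos (lt_min hδ₁ hδ₂) (C := 0) fun x hx hxδ => ?_
    rw [Real.enorm_eq_ofReal_abs]
    exact (hdist x hx hxδ).2
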